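/- For a finite simple graph $G$, a vertex coloring $c:V(G)\to\{1,\dots,k\}$ (not necessarily proper) is called edge-distinguishing if the induced edge labels $\{c(u),c(v)\}$ are distinct for all edges $uv$ of $G$. The edge-distinguishing chromatic number (EDCN) $\lambda(G)$ is the minimum positive integer $k$ for which an edge-distinguishing vertex coloring with $k$ colors exists. Let $j,n\in\mathbb{N}$ with $2\le j\le \frac n2$, and let $C_n^{\{0,j\}}$ be the graph obtained from the cycle with vertices $w_0,w_1,\dots,w_{n-1}$ (in cyclic order) by adding the chord $w_0w_j$. Let $e=n+1$; this is the number of edges of $C_n^{\{0,j\}}$. Then $$\lambda(C_n^{\{0,2\}})=\begin{cases} 4 & \text{if } e\le 8,\\ 5 & \text{if } e=9,\\ \left\lceil\frac{-1+\sqrt{8e+17}}{2}\right\rceil & \text{if } e\ge 10 \text{ and } \left\lceil\frac{-1+\sqrt{8e+17}}{2}\right\rceil \text{ is odd},\\ \left\lceil\sqrt{2e-2}\right\rceil & \text{otherwise,} \end{cases}$$ and if $j\ge 3$, then $$\lambda(C_n^{\{0,j\}})=\begin{cases} 4 & \text{if } e\le 6,\\ \left\lceil\frac{-1+\sqrt{8e+1}}{2}\right\rceil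 & \text{if } e\ge 7 \text{ and } \left\lceil\frac{-1+\sqrt{8e+1}}{2}\right\rceil \text{ is odd},\\ \left\lceil\sqrt{2e-2}\right\rceil & \text{otherwise.} \end{cases}$$ -/

import Mathlib

/-- The vertex coloring `c` is edge-distinguishing: the induced edge labels `{c u, c v}` (as unordered
pairs, with repetition allowed) are distinct for distinct edges. The coloring need not be proper. -/
def SimpleGraph.IsEdgeDistinguishing {V α : Type*} (G : SimpleGraph V) (c : V → α) : Prop :=
  Set.InjOn (Sym2.map c) G.edgeSet

/-- The edge-distinguishing chromatic number: the least positive integer `k` such that `G` has an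
edge-distinguishing vertex coloring with `k` colors (not all of which need to be used).
Such a `k` exists for every finite graph. -/
noncomputable def SimpleGraph.edcn {V : Type*} (G : SimpleGraph V) : ℕ :=
  sInf {k : ℕ | 0 < k ∧ ∃ c : V → Fin k, G.IsEdgeDistinguishing c}

/-- The cycle on the vertices `0, 1, …, n - 1` together with the chord between `0` and `j`. -/
def chordedCycle (n j : ℕ) : SimpleGraph (Fin n) :=
  SimpleGraph.cycleGraph n ⊔ SimpleGraph.fromRel (fun u v : Fin n => u.val = 0 ∧ v.val = j)

/-!
The argument has two halves: bounds on the number of edges in terms of the number `k` of colours,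
and colourings that attain them.

*Bounds.* An edge-distinguishing colouring with `k` colours embeds the edges of the chorded cycle
into the edges and loops of the complete graph on `k` vertices. There are `k * (k + 1) / 2` of these,
and `missingLabels` is the set of those that are not used. The cycle becomes a closed walk, which
uses an even number of non-loop edges at every colour, and the chord changes this parity at exactly
its two end colours, if these differ (`odd_card_missingLabels`). For even `k` there are `k - 1`
non-loop edges at each colour, an odd number, so a label is missing at each colour off the chord and
`2 * e ≤ k ^ 2 + 2` (`card_le_of_even`). If the chord cuts off a triangle, its ends have different
colours, and for odd `k` a label is missing at both of them, so `2 * e + 4 ≤ k * (k + 1)`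
(`card_le_of_odd`). The only further obstruction is that a chord cutting off a triangle leaves at
most eight edges for four colours (`le_three_of_card_eq_four`).

*Colourings.* A colouring is written as the closed word of the colours along the cycle, starting with
colour `0` at one end of the chord (`IsThetaWord`). With two new colours `x` and `y` one can insert,
at the end of such a word, a closed walk through `0` that uses only new labels: it is composed of
quadrilaterals `x, v, y, v'`, which pair off old colours `v` and `v'`, of possible loops at `x` and
`y`, and of a triangle `0, x, y` if the number of old colours is odd
(`HasThetaWord.insert_quads`). The possible lengths of this walk (`HasThetaWord.step_even`,
`HasThetaWord.step_odd`) suffice to pass from the relevant lengths for `k` colours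
to those for `k + 2` colours. The insertion lengthens one side of the chord and keeps the other, and
since the sides can be exchanged (`HasThetaWord.symm`), all positions of the chord are obtained except
for small `k` and chords close to a diameter. These exceptions and the initial cases are the finite
list `sporadicWords`.

What remains is to compare the bounds for even and odd `k` (`edcn_chordedCycle`,
`edcn_chordedCycle_two`).
-/

/-! ### Walks and their edges -/

/-- The edges traversed by a walk that is given by the list of its vertices. -/
def trailEdges {α : Type*} (l : List α) : List (Sym2 α) :=
  List.zipWith (fun u v => s(u, v)) l l.tail

section trailEdges
variable {α : Type*}

@[simp] lemma trailEdges_nil : trailEdges ([] : List α) = [] := rfl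

@[simp] lemma trailEdges_singleton (u : α) : trailEdges [u] = [] := rfl

@[simp] lemma trailEdges_cons_cons (u v : α) (l : List α) :
    trailEdges (u :: v :: l) = s(u, v) :: trailEdges (v :: l) := rfl

lemma trailEdges_append (l₁ : List α) (v : α) (l₂ : List α) :
    trailEdges (l₁ ++ v :: l₂) = trailEdges (l₁ ++ [v]) ++ trailEdges (v :: l₂) := by
  induction l₁ with
  | nil => simp
  | cons u l ih => cases l <;> simp_all

lemma trailEdges_reverse_perm (l : List α) : (trailEdges l.reverse).Perm (trailEdges l) := by
  induction l with
  | nil => simp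
  | cons u l ih =>
    cases l with
    | nil => simp
    | cons v l =>
      have h : (u :: v :: l).reverse = l.reverse ++ v :: [u] := by simp
      rw [h, trailEdges_append, trailEdges_cons_cons, trailEdges_cons_cons, Sym2.eq_swap]
      simpa using (List.perm_append_singleton _ _).trans (List.Perm.cons s(u, v) (by simpa using ih))

lemma mem_of_mem_trailEdges {l : List α} {e : Sym2 α} (he : e ∈ trailEdges l) {v : α}
    (hv : v ∈ e) : v ∈ l := by
  induction l with
  | nil => simp at he
  | cons u l ih =>
    cases l with
    | nil => simp at he
    | cons w l =>
      rw [trailEdges_cons_cons, List.mem_cons] at he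
      rcases he with rfl | he
      · rw [Sym2.mem_iff] at hv
        rcases hv with rfl | rfl <;> simp
      · exact List.mem_cons_of_mem _ (ih he)

end trailEdges

/-! ### Theta words -/

/-- The closed word `0, p, b, q` (read cyclically) lists the colours of the vertices of a cycle whose
chord joins the initial vertex, of colour `0`, to the vertex coloured `b`. All colours are less than
`k`, and the chord and the cycle edges receive distinct labels. -/
def IsThetaWord (k : ℕ) (p : List ℕ) (b : ℕ) (q : List ℕ) : Prop :=
  (∀ v ∈ 0 :: p ++ b :: q, v < k) ∧ (s(0, b) :: trailEdges (0 :: p ++ b :: q ++ [0])).Nodup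

instance (k : ℕ) (p : List ℕ) (b : ℕ) (q : List ℕ) : Decidable (IsThetaWord k p b q) := by
  unfold IsThetaWord; infer_instance

/-- Some theta word with colours less than `k` has length `n`, with the chord spanning `j` edges of
the cycle. -/
def HasThetaWord (k n j : ℕ) : Prop :=
  ∃ p b q, IsThetaWord k p b q ∧ p.length + 1 = j ∧ p.length + q.length + 2 = n

/-- Reading the cycle backwards exchanges the two sides of the chord. -/
lemma HasThetaWord.symm {k n j : ℕ} (h : HasThetaWord k n j) : HasThetaWord k n (n - j) := by
  obtain ⟨p, b, q, ⟨hk, hnd⟩, hj, hn⟩ := h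
  have hrev : 0 :: q.reverse ++ b :: p.reverse ++ [0] = (0 :: p ++ b :: q ++ [0]).reverse := by simp
  refine ⟨q.reverse, b, p.reverse, ⟨fun v hv => hk v ?_, ?_⟩, by simp; omega, by simp; omega⟩
  · simp at hv ⊢; tauto
  · rw [hrev]
    exact ((trailEdges_reverse_perm _).cons _).nodup_iff.2 hnd

/-- A closed walk through `0` all of whose edges use one of the new colours `k`, `k + 1` can be
inserted at the end of a theta word. -/
lemma HasThetaWord.insert {k n j : ℕ} (h : HasThetaWord k n j) {l : List ℕ}
    (hl : ∀ v ∈ l, v < k + 2) (hnd : (trailEdges (0 :: (l ++ [0]))).Nodup)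
    (hnew : ∀ e ∈ trailEdges (0 :: (l ++ [0])), k ∈ e ∨ k + 1 ∈ e) :
    HasThetaWord (k + 2) (n + (l.length + 1)) j := by
  obtain ⟨p, b, q, ⟨hk, hnd'⟩, hj, hn⟩ := h
  have hw : 0 :: p ++ b :: (q ++ 0 :: l) ++ [0] = (0 :: p ++ b :: q) ++ 0 :: (l ++ [0]) := by simp
  refine ⟨p, b, q ++ 0 :: l, ⟨fun v hv => ?_, ?_⟩, hj, by simp; omega⟩
  · by_cases hv' : v ∈ l
    · exact hl v hv'
    · have := hk v (by simp at hv ⊢; tauto)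
      omega
  · have hlt : ∀ e ∈ s(0, b) :: trailEdges (0 :: p ++ b :: q ++ [0]), ∀ v ∈ e, v < k := by
      intro e he v hv
      rcases List.mem_cons.1 he with rfl | he
      · apply hk; rw [Sym2.mem_iff] at hv; rcases hv with rfl | rfl <;> simp
      · have := mem_of_mem_trailEdges he hv
        apply hk
        simp at this ⊢
        tauto
    rw [hw, trailEdges_append, ← List.cons_append]
    refine hnd'.append hnd fun e he he' => ?_
    rcases hnew e he' with h | h <;> have := hlt e he _ h <;> omega

/-! ### Inserting quadrilaterals -/

/-- The walk `s, y, s + 1, x, s + 2, y, s + 3, x, …` with `m` blocks: continuing a walk that ends at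
`x`, it runs through the `m` quadrilaterals `x, s + 2 * i, y, s + 2 * i + 1`. -/
def quads (x y : ℕ) : ℕ → ℕ → List ℕ
  | _, 0 => []
  | s, m + 1 => s :: y :: (s + 1) :: x :: quads x y (s + 2) m

lemma length_quads (x y s m : ℕ) : (quads x y s m).length = 4 * m := by
  induction m generalizing s with
  | zero => rfl
  | succ m ih => simp [quads, ih]; omega

lemma mem_quads {x y s m v : ℕ} (h : v ∈ quads x y s m) : v = x ∨ v = y ∨ v < s + 2 * m := by
  induction m generalizing s with
  | zero => simp [quads] at h
  | succ m ih =>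
    simp only [quads, List.mem_cons] at h
    rcases h with rfl | rfl | rfl | rfl | h
    · omega
    · omega
    · omega
    · omega
    · have := ih h; omega

lemma mem_trailEdges_quads {x y : ℕ} {l : List ℕ} {e : Sym2 ℕ} (m s : ℕ)
    (he : e ∈ trailEdges (x :: (quads x y s m ++ l))) :
    e ∈ trailEdges (x :: l) ∨ ∃ v, s ≤ v ∧ v < s + 2 * m ∧ (e = s(v, x) ∨ e = s(v, y)) := by
  induction m generalizing s with
  | zero => exact Or.inl (by simpa [quads] using he)
  | succ m ih =>
    simp only [quads, List.cons_append, trailEdges_cons_cons, List.mem_cons] at he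
    rcases he with rfl | rfl | rfl | rfl | h
    · exact Or.inr ⟨s, by omega, by omega, Or.inl Sym2.eq_swap⟩
    · exact Or.inr ⟨s, by omega, by omega, Or.inr rfl⟩
    · exact Or.inr ⟨s + 1, by omega, by omega, Or.inr Sym2.eq_swap⟩
    · exact Or.inr ⟨s + 1, by omega, by omega, Or.inl rfl⟩
    · rcases ih _ h with h | ⟨v, h1, h2, h3⟩
      · exact Or.inl h
      · exact Or.inr ⟨v, by omega, by omega, h3⟩

lemma nodup_trailEdges_quads {x y : ℕ} {l : List ℕ} (hxy : x ≠ y)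
    (hl : (trailEdges (x :: l)).Nodup) (m s : ℕ) (hx : s + 2 * m ≤ x) (hy : s + 2 * m ≤ y)
    (hnew : ∀ v, s ≤ v → v < s + 2 * m →
      s(v, x) ∉ trailEdges (x :: l) ∧ s(v, y) ∉ trailEdges (x :: l)) :
    (trailEdges (x :: (quads x y s m ++ l))).Nodup := by
  induction m generalizing s with
  | zero => simpa [quads] using hl
  | succ m ih =>
    have hrec := ih (s + 2) (by omega) (by omega) fun v h1 h2 => hnew v (by omega) (by omega)
    have hout : ∀ v, s ≤ v → v < s + 2 →
        s(v, x) ∉ trailEdges (x :: (quads x y (s + 2) m ++ l)) ∧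
        s(v, y) ∉ trailEdges (x :: (quads x y (s + 2) m ++ l)) := by
      intro v h1 h2
      have hv := hnew v h1 (by omega)
      constructor <;> intro h <;> rcases mem_trailEdges_quads _ _ h with h | ⟨u, h3, h4, h5⟩
      · exact hv.1 h
      · simp only [Sym2.eq_iff] at h5; omega
      · exact hv.2 h
      · simp only [Sym2.eq_iff] at h5; omega
    have h0 := hout s (by omega) (by omega)
    have h1 := hout (s + 1) (by omega) (by omega)
    rw [Sym2.eq_swap] at h0
    simp only [quads, List.cons_append, trailEdges_cons_cons, List.nodup_cons, List.mem_cons,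
      not_or]
    refine ⟨⟨?_, ?_, ?_, h0.1⟩, ⟨?_, ?_, h0.2⟩, ⟨?_, ?_⟩, h1.1, hrec⟩
    all_goals first | (rw [Sym2.eq_swap]; exact h1.2) | (simp only [Sym2.eq_iff]; omega)

/-- The closed walk at `0` made of `0, x, y` (if `z = []`) or `0, x, z, y` (if `z` is a single
vertex), the quadrilaterals through `x` and `y` and optional loops at `x` and `y`, where `x = k` and
`y = k + 1` are new colours. -/
lemma HasThetaWord.insert_quads {k n j : ℕ} (h : HasThetaWord k n j) (m r₁ r₂ : ℕ) (z : List ℕ)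
    (hz : z = [] ∨ z = [2 * m + 1]) (hm : 2 * m + z.length < k)
    (hr₁ : r₁ ≤ 1) (hr₂ : r₂ ≤ 1) :
    HasThetaWord (k + 2) (n + (4 * m + 3 + z.length + r₁ + r₂)) j := by
  set x := k with hx
  set y := k + 1 with hy
  let l := z ++ (List.replicate (r₂ + 1) y ++ [0])
  have key : (trailEdges (x :: l)).Nodup ∧ (∀ e ∈ trailEdges (x :: l), x ∈ e ∨ y ∈ e) ∧
      (∀ v, v < 2 * m + 1 → s(v, x) ∉ trailEdges (x :: l) ∧
        (v ≠ 0 → s(v, y) ∉ trailEdges (x :: l))) ∧ s(x, x) ∉ trailEdges (x :: l) := by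
    obtain rfl | rfl : r₂ = 0 ∨ r₂ = 1 := by omega
    all_goals
      rcases hz with rfl | rfl
    all_goals
      simp only [List.length_nil, List.length_cons] at hm
      simp [l, List.replicate_succ]
      refine ⟨?_, ?_, ?_⟩ <;> grind
  obtain ⟨k1, k2, k3, k4⟩ := key
  have hq := nodup_trailEdges_quads (x := x) (y := y) (by omega) k1 m 1 (by omega) (by omega)
    fun v h1 h2 => ⟨(k3 v (by omega)).1, (k3 v (by omega)).2 (by omega)⟩
  have hq' : ∀ e ∈ trailEdges (x :: (quads x y 1 m ++ l)), x ∈ e ∨ y ∈ e := by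
    intro e he
    rcases mem_trailEdges_quads _ _ he with he | ⟨v, -, -, rfl | rfl⟩
    · exact k2 e he
    · simp
    · simp
  have h0 : s(0, x) ∉ trailEdges (x :: (quads x y 1 m ++ l)) := by
    intro he
    rcases mem_trailEdges_quads _ _ he with he | ⟨v, h1, h2, h3⟩
    · exact (k3 0 (by omega)).1 he
    · simp only [Sym2.eq_iff] at h3; omega
  have hxx : s(x, x) ∉ trailEdges (x :: (quads x y 1 m ++ l)) := by
    intro he
    rcases mem_trailEdges_quads _ _ he with he | ⟨v, h1, h2, h3⟩
    · exact k4 he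
    · simp only [Sym2.eq_iff] at h3; omega
  have hins := h.insert
    (l := List.replicate (r₁ + 1) x ++ (quads x y 1 m ++ (z ++ List.replicate (r₂ + 1) y)))
    (by
      intro v hv
      simp only [List.mem_append, List.mem_replicate] at hv
      rcases hv with hv | hv | hv | hv
      · omega
      · have := mem_quads hv; omega
      · rcases hz with rfl | rfl
        · simp at hv
        · simp at hv hm; omega
      · omega)
    (by
      have : r₁ = 0 ∨ r₁ = 1 := by omega
      rcases this with rfl | rfl
      · simpa [l] using ⟨h0, hq⟩
      · simp only [l] at h0 hq hxx
        simp
        refine ⟨⟨by omega, h0⟩, hxx, hq⟩)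
    (by
      have : r₁ = 0 ∨ r₁ = 1 := by omega
      rcases this with rfl | rfl
      · simpa [l] using hq'
      · simpa [l] using hq')
  convert hins using 1
  simp [length_quads]
  omega

/-- For even `k` the old colours are matched into pairs `{0, k - 1}, {1, 2}, {3, 4}, …`, each
spanning a quadrilateral with the two new colours; `r` is the number of loops at the new colours. -/
lemma HasThetaWord.step_even {h n j r : ℕ} (hh : 1 ≤ h) (hr : r ≤ 2)
    (H : HasThetaWord (2 * h) n j) : HasThetaWord (2 * h + 2) (n + (4 * h + r)) j := by
  have := H.insert_quads (h - 1) (min r 1) (r - 1) [2 * (h - 1) + 1] (Or.inr rfl)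
    (by simp; omega) (by omega) (by omega)
  convert this using 1
  simp; omega

/-- For odd `k` either the old colours other than `0` are paired off and `0` spans a triangle with
the new colours, with `r - 1` loops; or, for `r = 0`, one old colour is left out, the rest is treated
as for even `k`, and both loops are used. -/
lemma HasThetaWord.step_odd {h n j r : ℕ} (hh : 1 ≤ h) (hr : r ≤ 3)
    (H : HasThetaWord (2 * h + 1) n j) :
    HasThetaWord (2 * h + 1 + 2) (n + (4 * h + 2 + r)) j := by
  obtain rfl | hr0 := Nat.eq_zero_or_pos r
  · have := H.insert_quads (h - 1) 1 1 [2 * (h - 1) + 1] (Or.inr rfl) (by simp; omega) le_rfl le_rfl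
    convert this using 1
    simp; omega
  · have := H.insert_quads h (min (r - 1) 1) (r - 2) [] (Or.inl rfl) (by simp) (by omega) (by omega)
    convert this using 1
    simp; omega

/-! ### Words attaining the bounds -/

/-- Theta words `(k, j, w)`: the closed word `w` uses colours less than `k` and the chord joins its
entries number `0` and `j`. These are the small cases that are not reached by inserting
quadrilaterals. -/
def sporadicWords : List (ℕ × ℕ × List ℕ) :=
  [(4, 2, [0, 2, 1, 3]),
   (4, 2, [0, 2, 1, 3, 3]),
   (4, 2, [0, 2, 1, 3, 3, 0]),
   (4, 3, [0, 2, 2, 1, 1, 3]),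
   (4, 2, [0, 2, 3, 3, 1, 1, 0]),
   (4, 3, [0, 1, 1, 3, 2, 2, 0]),
   (4, 3, [0, 2, 2, 1, 1, 3, 3, 0]),
   (4, 4, [0, 3, 3, 1, 1, 2, 2, 0]),
   (5, 2, [0, 1, 2, 4, 1, 3, 3, 0]),
   (5, 2, [0, 3, 1, 2, 2, 3, 4, 4, 0]),
   (5, 3, [0, 4, 1, 3, 2, 2, 1, 1, 0]),
   (5, 4, [0, 4, 2, 1, 3, 3, 4, 4, 1]),
   (5, 2, [0, 2, 1, 4, 3, 2, 2, 4, 4, 0]),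
   (5, 3, [0, 4, 4, 3, 3, 1, 2, 4, 1, 0]),
   (5, 4, [0, 2, 2, 3, 1, 1, 4, 3, 3, 0]),
   (5, 5, [0, 0, 1, 4, 3, 3, 1, 2, 2, 4]),
   (5, 2, [0, 2, 3, 4, 2, 2, 1, 1, 4, 4, 0]),
   (5, 3, [0, 4, 2, 3, 4, 4, 1, 1, 2, 2, 0]),
   (5, 4, [0, 3, 2, 1, 0, 4, 4, 1, 3, 4, 2]),
   (5, 5, [0, 0, 1, 4, 4, 2, 2, 1, 1, 3, 4]),
   (5, 2, [0, 2, 3, 3, 1, 1, 4, 4, 2, 2, 1, 0]),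
   (5, 3, [0, 4, 1, 2, 2, 4, 4, 3, 3, 1, 1, 0]),
   (5, 4, [0, 0, 2, 1, 1, 3, 3, 2, 2, 4, 4, 3]),
   (5, 5, [0, 1, 3, 2, 4, 0, 3, 4, 1, 1, 2, 2]),
   (5, 6, [0, 2, 4, 1, 1, 3, 0, 1, 2, 2, 3, 4]),
   (5, 3, [0, 3, 4, 0, 1, 4, 4, 2, 2, 3, 1, 1, 2]),
   (5, 4, [0, 4, 3, 3, 0, 1, 1, 3, 2, 4, 4, 1, 2]),
   (5, 5, [0, 4, 4, 1, 2, 0, 1, 3, 2, 2, 4, 3, 3]),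
   (5, 6, [0, 3, 2, 2, 4, 4, 0, 2, 1, 4, 3, 1, 1]),
   (5, 3, [0, 4, 3, 0, 1, 3, 3, 2, 2, 4, 4, 1, 1, 2]),
   (5, 4, [0, 4, 2, 3, 0, 2, 2, 1, 1, 3, 3, 4, 4, 1]),
   (5, 5, [0, 1, 1, 4, 3, 0, 2, 3, 3, 1, 2, 2, 4, 4]),
   (5, 6, [0, 1, 4, 4, 2, 2, 0, 3, 3, 2, 1, 1, 3, 4]),
   (5, 7, [0, 1, 3, 4, 1, 1, 2, 0, 4, 4, 2, 2, 3, 3]),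
   (6, 4, [0, 5, 3, 2, 2, 5, 5, 1, 3, 3, 0, 4, 2, 1, 0]),
   (6, 5, [0, 5, 4, 4, 3, 0, 2, 3, 3, 5, 1, 1, 2, 4, 1]),
   (6, 6, [0, 2, 3, 0, 4, 1, 1, 3, 5, 2, 2, 1, 5, 5, 0]),
   (6, 7, [0, 0, 4, 1, 3, 5, 4, 3, 2, 0, 1, 1, 2, 2, 5]),
   (6, 5, [0, 2, 4, 4, 3, 3, 2, 1, 5, 0, 0, 1, 3, 5, 5, 4]),
   (6, 6, [0, 2, 3, 4, 5, 3, 3, 1, 5, 5, 0, 0, 4, 2, 1, 1]),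
   (6, 7, [0, 1, 4, 3, 0, 5, 4, 4, 2, 1, 1, 3, 5, 2, 2, 0]),
   (6, 8, [0, 5, 4, 2, 3, 5, 5, 1, 4, 3, 3, 1, 1, 2, 2, 0]),
   (6, 6, [0, 5, 5, 1, 0, 2, 4, 3, 1, 1, 4, 4, 5, 2, 2, 3, 3]),
   (6, 7, [0, 2, 2, 5, 1, 4, 2, 1, 1, 3, 4, 4, 0, 5, 3, 3, 0]),
   (6, 8, [0, 2, 3, 5, 0, 1, 1, 3, 3, 4, 2, 2, 1, 5, 5, 4, 0]),
   (6, 2, [0, 4, 1, 5, 0, 0, 2, 3, 5, 5, 4, 4, 2, 2, 1, 1, 3, 3]),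
   (6, 6, [0, 5, 4, 4, 0, 1, 3, 5, 5, 2, 3, 3, 4, 1, 1, 2, 2, 0]),
   (6, 7, [0, 5, 2, 2, 3, 0, 4, 1, 3, 3, 4, 4, 5, 5, 1, 1, 2, 0]),
   (6, 8, [0, 1, 4, 4, 2, 2, 5, 3, 2, 1, 1, 5, 5, 0, 0, 4, 3, 3]),
   (6, 9, [0, 0, 5, 1, 0, 3, 4, 5, 5, 2, 2, 1, 1, 3, 3, 2, 4, 4]),
   (7, 7, [0, 2, 4, 1, 2, 2, 3, 4, 4, 5, 6, 0, 3, 1, 1, 5, 3, 6, 1]),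
   (7, 8, [0, 2, 6, 1, 5, 0, 4, 4, 1, 1, 2, 5, 5, 4, 3, 2, 2, 4, 6]),
   (7, 9, [0, 3, 5, 1, 0, 5, 2, 2, 3, 6, 2, 1, 4, 5, 5, 6, 6, 4, 0]),
   (7, 8, [0, 6, 3, 1, 5, 5, 4, 1, 2, 5, 3, 3, 2, 4, 6, 1, 1, 0, 3, 4]),
   (7, 9, [0, 0, 5, 2, 2, 6, 0, 1, 5, 4, 6, 6, 1, 3, 4, 1, 1, 2, 3, 3]),
   (7, 10, [0, 6, 2, 1, 1, 4, 4, 6, 5, 5, 2, 2, 4, 5, 3, 1, 6, 6, 3, 3]),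
   (7, 9, [0, 6, 6, 2, 1, 1, 6, 3, 4, 0, 1, 3, 0, 5, 6, 4, 1, 5, 4, 4, 2]),
   (7, 10, [0, 1, 1, 6, 5, 4, 2, 3, 6, 6, 0, 4, 4, 6, 2, 0, 3, 5, 1, 2, 5]),
   (7, 10, [0, 1, 1, 5, 4, 2, 2, 6, 6, 3, 0, 6, 1, 4, 3, 3, 2, 1, 3, 5, 5, 2]),
   (7, 11, [0, 6, 5, 5, 0, 4, 1, 6, 2, 2, 5, 1, 2, 4, 3, 3, 6, 4, 4, 5, 3, 0]),
   (7, 11, [0, 2, 2, 5, 6, 6, 2, 4, 4, 3, 1, 6, 4, 0, 3, 2, 1, 5, 5, 4, 1, 1, 0]),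
   (7, 12, [0, 5, 2, 1, 6, 3, 3, 4, 5, 3, 2, 4, 1, 1, 5, 5, 6, 6, 2, 2, 0, 6, 4, 4]),
   (7, 12, [0, 2, 2, 5, 1, 1, 4, 4, 6, 0, 5, 3, 0, 4, 3, 1, 6, 3, 3, 2, 6, 5, 4, 2, 1]),
   (7, 12, [0, 2, 1, 6, 4, 5, 0, 1, 3, 3, 4, 4, 0, 3, 6, 2, 4, 1, 1, 5, 3, 2, 2, 5, 5, 6]),
   (7, 13, [0, 6, 2, 1, 4, 6, 6, 1, 1, 0, 4, 2, 5, 0, 2, 2, 3, 5, 1, 3, 6, 5, 4, 4, 3, 3]),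
   (7, 12, [0, 1, 2, 5, 1, 6, 3, 3, 0, 2, 6, 5, 0, 4, 3, 5, 5, 4, 1, 1, 3, 2, 2, 4, 4, 6, 6]),
   (7, 13, [0, 4, 1, 3, 4, 6, 0, 5, 2, 3, 5, 5, 1, 0, 3, 3, 6, 6, 2, 1, 1, 6, 5, 4, 4, 2, 2]),
   (8, 13, [0, 0, 7, 1, 6, 4, 3, 6, 5, 7, 3, 5, 1, 3, 2, 5, 4, 2, 7, 7, 4, 4, 1, 0, 2, 2, 6, 6]),
   (8, 14, [0, 2, 1, 5, 4, 0, 1, 1, 3, 5, 7, 6, 2, 5, 5, 6, 4, 3, 6, 6, 1, 7, 7, 2, 3, 3, 7, 0]),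
   (8, 14, [0, 7, 1, 3, 3, 0, 0, 5, 7, 7, 4, 0, 1, 4, 6, 3, 7, 6, 5, 2, 6, 6, 1, 1, 5, 4, 3, 2,
      2]),
   (8, 15, [0, 6, 1, 4, 3, 1, 5, 2, 3, 3, 5, 7, 0, 1, 7, 3, 6, 6, 7, 2, 2, 4, 6, 2, 0, 4, 4, 5, 5,
      0]),
   (8, 16, [0, 3, 4, 1, 6, 2, 7, 7, 6, 6, 5, 5, 1, 3, 7, 1, 1, 2, 2, 5, 4, 2, 0, 5, 3, 3, 6, 0, 0,
      4, 4, 7])]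

lemma isThetaWord_of_mem_sporadicWords : ∀ x ∈ sporadicWords,
    IsThetaWord x.1 (x.2.2.take x.2.1).tail (x.2.2.getD x.2.1 0) (x.2.2.drop (x.2.1 + 1)) := by
  decide +kernel

lemma HasThetaWord.of_sporadic {k n j : ℕ} (hj : 1 ≤ j) (hjn : j < n)
    (h : ∃ x ∈ sporadicWords, x.1 = k ∧ x.2.1 = j ∧ x.2.2.length = n) : HasThetaWord k n j := by
  obtain ⟨x, hx, rfl, rfl, rfl⟩ := h
  refine ⟨_, _, _, isThetaWord_of_mem_sporadicWords x hx, ?_, ?_⟩ <;> simp <;> omega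

/-- Up to exchanging the two sides of the chord, `j` is at most half of `n`. -/
lemma HasThetaWord.of_forall_two_mul_le {k n j : ℕ} (hj : 3 ≤ j) (hjn : j + 3 ≤ n)
    (H : ∀ i, 3 ≤ i → 2 * i ≤ n → HasThetaWord k n i) : HasThetaWord k n j := by
  by_cases h : 2 * j ≤ n
  · exact H j hj h
  · have := (H (n - j) (by omega) (by omega)).symm
    rwa [Nat.sub_sub_self (by omega)] at this

/-- The upper bound `2 * h ^ 2` on `n` is forced by parity. Below `2 * h ^ 2 - h`, fewer than `2 * h`
colours are enough. -/
lemma hasThetaWord_even {h : ℕ} (hh : 2 ≤ h) : ∀ {n j : ℕ}, 2 * h ^ 2 ≤ n + h → n ≤ 2 * h ^ 2 →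
    3 ≤ j → 2 * j ≤ n → HasThetaWord (2 * h) n j := by
  induction h, hh using Nat.le_induction with
  | base =>
    intro n j h1 h2 hj hjn
    have key : ∀ n ∈ Finset.Icc 6 8, ∀ j ∈ Finset.Icc 3 4, 2 * j ≤ n →
      ∃ x ∈ sporadicWords, x.1 = 4 ∧ x.2.1 = j ∧ x.2.2.length = n := by decide +kernel
    exact .of_sporadic (by omega) (by omega) (key n (Finset.mem_Icc.2 (by omega)) j
      (Finset.mem_Icc.2 (by omega)) hjn)
  | succ h hh ih =>
    intro n j h1 h2 hj hjn
    have e : 2 * (h + 1) ^ 2 = 2 * h ^ 2 + 4 * h + 2 := by ring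
    rw [e] at h1 h2
    have hsq : 2 * h ≤ h ^ 2 := by nlinarith
    -- the shortest insertion for which the induction hypothesis is available
    obtain ⟨m, r, rfl, hr1, hr2, hm⟩ : ∃ m r, n = m + (4 * h + r) ∧ 1 ≤ r ∧ r ≤ 2 ∧
        (r = 1 ∧ n < 2 * h ^ 2 + 4 * h + 2 ∨ m = 2 * h ^ 2) := by
      by_cases h3 : n < 2 * h ^ 2 + 4 * h + 2
      · exact ⟨n - (4 * h + 1), 1, by omega, le_rfl, by omega, Or.inl ⟨rfl, h3⟩⟩
      · exact ⟨n - (4 * h + 2), 2, by omega, by omega, le_rfl, Or.inr (by omega)⟩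
    by_cases hjm : j + 3 ≤ m
    · exact (HasThetaWord.of_forall_two_mul_le hj hjm
        fun i hi him => ih (by omega) (by omega) hi him).step_even (by omega) hr2
    · -- from `h = 4` on, half of the length leaves enough room for the whole insertion
      have h4 : h ≤ 3 := by
        by_contra! h4
        nlinarith
      have key : ∀ h ∈ Finset.Icc 2 3,
          ∀ n ∈ Finset.Icc (2 * h ^ 2 + 3 * h + 1) (2 * h ^ 2 + 4 * h + 2),
          ∀ j ∈ Finset.Icc 3 16, 2 * j ≤ n →
          (n < 2 * h ^ 2 + 4 * h + 2 → n < j + 3 + 4 * h + 1) →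
          (n = 2 * h ^ 2 + 4 * h + 2 → n < j + 3 + 4 * h + 2) →
          ∃ x ∈ sporadicWords, x.1 = 2 * (h + 1) ∧ x.2.1 = j ∧ x.2.2.length = n := by
        decide +kernel
      have : h ^ 2 ≤ 3 ^ 2 := Nat.pow_le_pow_left h4 2
      exact .of_sporadic (by omega) (by omega) (key h (Finset.mem_Icc.2 ⟨hh, h4⟩) _
        (Finset.mem_Icc.2 (by omega)) j (Finset.mem_Icc.2 (by omega)) hjn (by omega) (by omega))

/-- For `n = 2 * h ^ 2 + 3 * h` every edge and every loop of the complete graph is used. Up to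
`2 * h ^ 2`, fewer than `2 * h + 1` colours are enough. -/
lemma hasThetaWord_odd {h : ℕ} (hh : 2 ≤ h) : ∀ {n j : ℕ}, 2 * h ^ 2 < n →
    n ≤ 2 * h ^ 2 + 3 * h → 3 ≤ j → 2 * j ≤ n → HasThetaWord (2 * h + 1) n j := by
  induction h, hh using Nat.le_induction with
  | base =>
    intro n j h1 h2 hj hjn
    have key : ∀ n ∈ Finset.Icc 9 14, ∀ j ∈ Finset.Icc 3 7, 2 * j ≤ n →
      ∃ x ∈ sporadicWords, x.1 = 5 ∧ x.2.1 = j ∧ x.2.2.length = n := by decide +kernel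
    exact .of_sporadic (by omega) (by omega) (key n (Finset.mem_Icc.2 (by omega)) j
      (Finset.mem_Icc.2 (by omega)) hjn)
  | succ h hh ih =>
    intro n j h1 h2 hj hjn
    have e : 2 * (h + 1) ^ 2 = 2 * h ^ 2 + 4 * h + 2 := by ring
    rw [e] at h1 h2
    have hsq : 2 * h ≤ h ^ 2 := by nlinarith
    -- the shortest insertion for which the induction hypothesis is available
    obtain ⟨m, r, rfl, hr, hm⟩ : ∃ m r, n = m + (4 * h + 2 + r) ∧ r ≤ 3 ∧
        (r = 0 ∧ n ≤ 2 * h ^ 2 + 7 * h + 2 ∨ m = 2 * h ^ 2 + 3 * h) := by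
      by_cases h3 : n ≤ 2 * h ^ 2 + 7 * h + 2
      · exact ⟨n - (4 * h + 2), 0, by omega, by omega, Or.inl ⟨rfl, h3⟩⟩
      · exact ⟨2 * h ^ 2 + 3 * h, n - (2 * h ^ 2 + 7 * h + 2), by omega, by omega, Or.inr rfl⟩
    by_cases hjm : j + 3 ≤ m
    · exact (HasThetaWord.of_forall_two_mul_le hj hjm
        fun i hi him => ih (by omega) (by omega) hi him).step_odd (by omega) hr
    · -- from `h = 3` on, half of the length leaves enough room for the whole insertion
      obtain rfl : h = 2 := by
        by_contra! h4
        have : 3 * h ≤ h ^ 2 := by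
          have : 3 ≤ h := by omega
          nlinarith
        omega
      have key : ∀ n ∈ Finset.Icc 19 27, ∀ j ∈ Finset.Icc 3 13, 2 * j ≤ n →
          (n ≤ 24 → n < j + 13) → (24 < n → 12 ≤ j) →
          ∃ x ∈ sporadicWords, x.1 = 7 ∧ x.2.1 = j ∧ x.2.2.length = n := by
        decide +kernel
      exact .of_sporadic (by omega) (by omega) (key _ (Finset.mem_Icc.2 (by omega)) j
        (Finset.mem_Icc.2 (by omega)) hjn (by omega) (by omega))

/-- The triangle cut off by the chord is kept under insertions. The case `n = 8` is excluded for four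
colours, so the longer insertion is used as soon as the shorter one would start from the maximal
length. -/
lemma hasThetaWord_even_two {h : ℕ} (hh : 2 ≤ h) : ∀ {n : ℕ}, 2 * h ^ 2 ≤ n + h + 2 →
    n ≤ 2 * h ^ 2 → ¬ (h = 2 ∧ n = 8) → HasThetaWord (2 * h) n 2 := by
  induction h, hh using Nat.le_induction with
  | base =>
    intro n h1 h2 h3
    have key : ∀ n < 8, 4 ≤ n → ∃ x ∈ sporadicWords, x.1 = 4 ∧ x.2.1 = 2 ∧ x.2.2.length = n := by
      decide +kernel
    exact .of_sporadic (by omega) (by omega) (key n (by omega) (by omega))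
  | succ h hh ih =>
    intro n h1 h2 h3
    have e : 2 * (h + 1) ^ 2 = 2 * h ^ 2 + 4 * h + 2 := by ring
    rw [e] at h1 h2
    have hsq : 2 * h ≤ h ^ 2 := by nlinarith
    by_cases h4 : n ≤ 2 * h ^ 2 + 4 * h
    · obtain ⟨m, rfl⟩ : ∃ m, n = m + (4 * h + 1) := ⟨n - (4 * h + 1), by omega⟩
      exact (ih (by omega) (by omega) (by rintro ⟨rfl, rfl⟩; omega)).step_even (by omega) (by omega)
    · obtain ⟨m, rfl⟩ : ∃ m, n = m + (4 * h + 2) := ⟨n - (4 * h + 2), by omega⟩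
      by_cases h5 : h = 2 ∧ m = 8
      · obtain ⟨rfl, rfl⟩ := h5
        exact .of_sporadic (by omega) (by omega) (by decide +kernel)
      · exact (ih (by omega) (by omega) h5).step_even (by omega) le_rfl

/-- Compared with longer chords, two labels are lost, as the two colours of the chord differ and have
odd degree. -/
lemma hasThetaWord_odd_two {h : ℕ} (hh : 2 ≤ h) : ∀ {n : ℕ}, 2 * h ^ 2 < n →
    n + 2 ≤ 2 * h ^ 2 + 3 * h → HasThetaWord (2 * h + 1) n 2 := by
  induction h, hh using Nat.le_induction with
  | base =>
    intro n h1 h2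
    have key : ∀ n < 13, 9 ≤ n → ∃ x ∈ sporadicWords, x.1 = 5 ∧ x.2.1 = 2 ∧ x.2.2.length = n := by
      decide +kernel
    exact .of_sporadic (by omega) (by omega) (key n (by omega) (by omega))
  | succ h hh ih =>
    intro n h1 h2
    have e : 2 * (h + 1) ^ 2 = 2 * h ^ 2 + 4 * h + 2 := by ring
    rw [e] at h1 h2
    have hsq : 2 * h ≤ h ^ 2 := by nlinarith
    obtain ⟨m, r, rfl, hr, hm⟩ : ∃ m r, n = m + (4 * h + 2 + r) ∧ r ≤ 3 ∧
        (r = 0 ∧ n ≤ 2 * h ^ 2 + 7 * h ∨ m + 2 = 2 * h ^ 2 + 3 * h) := by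
      by_cases h3 : n ≤ 2 * h ^ 2 + 7 * h
      · exact ⟨n - (4 * h + 2), 0, by omega, by omega, Or.inl ⟨rfl, h3⟩⟩
      · exact ⟨2 * h ^ 2 + 3 * h - 2, n - (2 * h ^ 2 + 7 * h), by omega, by omega,
          Or.inr (by omega)⟩
    exact (ih (by omega) (by omega)).step_odd (by omega) hr

lemma hasThetaWord_five_eight_two : HasThetaWord 5 8 2 :=
  .of_sporadic (by omega) (by omega) (by decide +kernel)

/-! ### The edges of a chorded cycle and their labels -/

section chordedCycle
variable {m : ℕ}

/-- The edges of the cycle on `Fin (m + 2)` with the chord `s(0, j)`: the chord is number `none`, and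
`some i` is the number of the cycle edge `s(i, i + 1)`. -/
def chordedCycleEdge (j : Fin (m + 2)) : Option (Fin (m + 2)) → Sym2 (Fin (m + 2))
  | none => s(0, j)
  | some i => s(i, i + 1)

lemma range_chordedCycleEdge {j : Fin (m + 2)} (hj : j ≠ 0) :
    Set.range (chordedCycleEdge j) = (chordedCycle (m + 2) j).edgeSet := by
  ext e
  induction e using Sym2.ind with
  | _ u v =>
  simp only [Set.mem_range, Option.exists, chordedCycleEdge, SimpleGraph.mem_edgeSet, chordedCycle,
    SimpleGraph.sup_adj, SimpleGraph.cycleGraph_adj, SimpleGraph.fromRel_adj, Sym2.eq_iff]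
  have h0 : ∀ w : Fin (m + 2), w.val = 0 ↔ w = 0 := fun w => Fin.val_eq_zero_iff
  simp only [h0, ← Fin.ext_iff]
  constructor
  · rintro ((⟨rfl, rfl⟩ | ⟨rfl, rfl⟩) | ⟨i, ⟨rfl, rfl⟩ | ⟨rfl, rfl⟩⟩)
    · exact Or.inr ⟨hj.symm, Or.inl ⟨rfl, rfl⟩⟩
    · exact Or.inr ⟨hj, Or.inr ⟨rfl, rfl⟩⟩
    · exact Or.inl (Or.inr (by simp))
    · exact Or.inl (Or.inl (by simp))
  · rintro ((h | h) | ⟨-, ⟨rfl, rfl⟩ | ⟨rfl, rfl⟩⟩)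
    · exact Or.inr ⟨v, Or.inr ⟨rfl, by rw [← h]; simp⟩⟩
    · exact Or.inr ⟨u, Or.inl ⟨rfl, by rw [← h]; simp⟩⟩
    · exact Or.inl (Or.inl ⟨rfl, rfl⟩)
    · exact Or.inl (Or.inr ⟨rfl, rfl⟩)

lemma chordedCycleEdge_injective {j : Fin (m + 2)} (hj : 2 ≤ j.val) (hjm : j.val ≤ m) :
    Function.Injective (chordedCycleEdge j) := by
  rintro (_ | a) (_ | b) h
  · rfl
  all_goals
    simp only [chordedCycleEdge, Sym2.eq_iff, Fin.ext_iff, Fin.val_add_one, Fin.val_zero,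
      Fin.val_last] at h
    simp only [Option.some.injEq, Fin.ext_iff, reduceCtorEq]
    grind

lemma isEdgeDistinguishing_chordedCycle_iff {α : Type*} {j : Fin (m + 2)} (hj : 2 ≤ j.val)
    (hjm : j.val ≤ m) (c : Fin (m + 2) → α) :
    (chordedCycle (m + 2) j).IsEdgeDistinguishing c ↔
      Function.Injective fun o => (chordedCycleEdge j o).map c := by
  have hinj := chordedCycleEdge_injective hj hjm
  rw [SimpleGraph.IsEdgeDistinguishing, ← range_chordedCycleEdge (by rintro rfl; simp at hj)]
  constructor
  · intro h a b hab
    exact hinj (h ⟨a, rfl⟩ ⟨b, rfl⟩ hab)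
  · rintro h _ ⟨a, rfl⟩ _ ⟨b, rfl⟩ hab
    rw [h hab]

lemma ncard_edgeSet_chordedCycle {j : Fin (m + 2)} (hj : 2 ≤ j.val) (hjm : j.val ≤ m) :
    (chordedCycle (m + 2) j).edgeSet.ncard = m + 3 := by
  rw [← range_chordedCycleEdge (by rintro rfl; simp at hj), ← Set.image_univ,
    Set.ncard_image_of_injective _ (chordedCycleEdge_injective hj hjm), Set.ncard_univ]
  simp

end chordedCycle

/-! ### Colourings from theta words -/

lemma length_trailEdges {α : Type*} (l : List α) : (trailEdges l).length = l.length - 1 := by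
  simp [trailEdges]

lemma getElem_trailEdges {α : Type*} (l : List α) (i : ℕ) (hi : i < (trailEdges l).length) :
    (trailEdges l)[i] =
      s(l[i]'(by rw [length_trailEdges] at hi; omega),
        l[i + 1]'(by rw [length_trailEdges] at hi; omega)) := by
  simp [trailEdges]

lemma HasThetaWord.exists_isEdgeDistinguishing {k n j : ℕ} (h : HasThetaWord k n j) (hj : 2 ≤ j)
    (hjn : j + 2 ≤ n) : ∃ c : Fin n → Fin k, (chordedCycle n j).IsEdgeDistinguishing c := by
  obtain ⟨p, b, q, ⟨hk, hnd⟩, hpj, hpq⟩ := h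
  obtain ⟨m, rfl⟩ : ∃ m, n = m + 2 := ⟨n - 2, by omega⟩
  obtain ⟨j, rfl⟩ : ∃ i : Fin (m + 2), i.val = j := ⟨⟨j, by omega⟩, rfl⟩
  obtain ⟨w, hw⟩ : ∃ w, w = 0 :: p ++ b :: q := ⟨_, rfl⟩
  rw [← hw] at hk hnd
  have hlen : w.length = m + 2 := by simp [hw]; omega
  let c : Fin (m + 2) → Fin k := fun i => ⟨w[i.val]'(by omega), hk _ (List.getElem_mem _)⟩
  refine ⟨c, (isEdgeDistinguishing_chordedCycle_iff hj (by omega) c).2 ?_⟩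
  have hT : (trailEdges (w ++ [0])).length = m + 2 := by rw [length_trailEdges]; simp [hlen]
  have hnone : ((chordedCycleEdge j none).map c).map Fin.val = s(0, b) := by
    have : w[j.val]'(by omega) = b := by simp [hw, ← hpj]
    have h0 : w[0]'(by omega) = 0 := by simp [hw]
    simp [chordedCycleEdge, c, this, h0]
  have hsome : ∀ i : Fin (m + 2), ((chordedCycleEdge j (some i)).map c).map Fin.val =
      (trailEdges (w ++ [0]))[i.val]'(by omega) := by
    intro i
    have hi : w[i.val]'(by omega) = (w ++ [0])[i.val]'(by simp; omega) :=
      (List.getElem_append_left _).symm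
    have hi' : w[(i + 1).val]'(by rw [hlen]; exact (i + 1).isLt) =
        (w ++ [0])[i.val + 1]'(by simp; omega) := by
      have hv := Fin.val_add_one i
      split_ifs at hv with h
      · subst h
        rw [List.getElem_append_right (by rw [hlen]; rfl)]
        simp only [hv]
        simp [hw]
      · simp only [hv]
        exact (List.getElem_append_left _).symm
    rw [getElem_trailEdges]
    simp only [chordedCycleEdge, Sym2.map_mk, c, hi, hi']
  rw [List.nodup_cons] at hnd
  refine Function.Injective.of_comp (f := Sym2.map Fin.val) ?_
  rintro (_ | x) (_ | y) hxy <;> simp only [Function.comp_apply, hnone, hsome] at hxy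
  · rfl
  · exact absurd (hxy ▸ List.getElem_mem _) hnd.1
  · exact absurd (hxy ▸ List.getElem_mem _) hnd.1
  · rw [hnd.2.getElem_inj_iff] at hxy
    rw [Fin.ext hxy]

/-! ### Counting the labels that are not used -/

/-- If the chord cuts off a triangle, its ends get different colours. -/
lemma chord_ne {m : ℕ} {α : Type*} {c : Fin (m + 4) → α}
    (hc : Function.Injective fun o => (chordedCycleEdge 2 o).map c) : c 0 ≠ c 2 := by
  intro h
  have := @hc (some 0) (some 1) (by
    simp only [chordedCycleEdge, Sym2.map_mk, h, zero_add]
    rw [Sym2.eq_swap]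
    rfl)
  simp at this

section labels
open Finset

variable {m : ℕ} {α : Type*} [Fintype α] [DecidableEq α]

/-- The labels that are not used by a colouring of a chorded cycle. -/
def missingLabels (c : Fin (m + 2) → α) (j : Fin (m + 2)) : Finset (Sym2 α) :=
  univ \ univ.image fun o => (chordedCycleEdge j o).map c

/-- The labels that contain the colour `v` exactly once. -/
def labelStar (v : α) : Finset (Sym2 α) :=
  (univ.erase v).image fun u => s(v, u)

lemma mk_mem_labelStar {u v w : α} : s(u, w) ∈ labelStar v ↔ ¬ (u = v ↔ w = v) := by
  simp only [labelStar, mem_image, mem_erase, mem_univ, and_true, Sym2.eq_iff]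
  constructor
  · rintro ⟨x, hx, ⟨rfl, rfl⟩ | ⟨rfl, rfl⟩⟩ <;> simp [hx]
  · intro h
    by_cases hu : u = v
    · exact ⟨w, fun hw => h (by simp [hu, hw]), Or.inl ⟨hu.symm, rfl⟩⟩
    · exact ⟨u, hu, Or.inr ⟨by by_contra hw; exact h (by simp [hu, Ne.symm hw]), rfl⟩⟩

lemma card_labelStar (v : α) : #(labelStar v) + 1 = Fintype.card α := by
  rw [labelStar, card_image_of_injective _ fun a b h => Sym2.congr_right.1 h,
    card_erase_of_mem (mem_univ v), card_univ]
  exact Nat.sub_add_cancel (Fintype.card_pos_iff.2 ⟨v⟩)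

lemma two_mul_card_add_card_missingLabels {c : Fin (m + 2) → α} {j : Fin (m + 2)}
    (hc : Function.Injective fun o => (chordedCycleEdge j o).map c) :
    2 * (m + 3 + #(missingLabels c j)) = Fintype.card α * (Fintype.card α + 1) := by
  have h := card_sdiff_add_card_eq_card
    (subset_univ (univ.image fun o => (chordedCycleEdge j o).map c))
  rw [card_image_of_injective _ hc, card_univ, card_univ, Sym2.card, Nat.choose_two_right] at h
  simp only [Fintype.card_option, Fintype.card_fin] at h
  have h2 : 2 ∣ (Fintype.card α + 1) * Fintype.card α := by
    rw [mul_comm]; exact (Nat.even_mul_succ_self _).two_dvd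
  have : m + 3 + #(missingLabels c j) = (Fintype.card α + 1) * Fintype.card α / 2 := by
    rw [missingLabels]; simp only [Nat.add_sub_cancel] at h; omega
  rw [this, Nat.mul_div_cancel' h2, mul_comm]

/-- A closed walk enters and leaves every vertex equally often. -/
lemma even_card_cycle_labels (c : Fin (m + 2) → α) (v : α) :
    Even #{i | s(c i, c (i + 1)) ∈ labelStar v} := by
  have h1 : ∑ i, ((if c i = v then 1 else 0) + if c (i + 1) = v then 1 else 0) =
      2 * ∑ i, if c i = v then 1 else 0 := by
    rw [sum_add_distrib, two_mul]
    congr 1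
    exact Equiv.sum_comp (Equiv.addRight 1) fun i => if c i = v then 1 else 0
  have h2 : ∑ i, ((if c i = v then 1 else 0) + if c (i + 1) = v then 1 else 0) =
      #{i | s(c i, c (i + 1)) ∈ labelStar v} + 2 * #{i | c i = v ∧ c (i + 1) = v} := by
    rw [card_filter, card_filter, mul_sum, ← sum_add_distrib]
    refine sum_congr rfl fun i _ => ?_
    simp only [mk_mem_labelStar]
    split_ifs <;> simp_all
  rw [h1] at h2
  exact ⟨(∑ i, if c i = v then 1 else 0) - #{i | c i = v ∧ c (i + 1) = v}, by omega⟩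

lemma card_labels_at {c : Fin (m + 2) → α} {j : Fin (m + 2)}
    (hc : Function.Injective fun o => (chordedCycleEdge j o).map c) (v : α) :
    #(missingLabels c j ∩ labelStar v) + #{i | s(c i, c (i + 1)) ∈ labelStar v} +
      (if s(c 0, c j) ∈ labelStar v then 1 else 0) + 1 = Fintype.card α := by
  have h1 : #{o | (chordedCycleEdge j o).map c ∈ labelStar v} =
      #{i | s(c i, c (i + 1)) ∈ labelStar v} +
        if s(c 0, c j) ∈ labelStar v then 1 else 0 := by
    rw [card_filter, card_filter, Fintype.sum_option]
    exact add_comm _ _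
  have h2 : labelStar v \ missingLabels c j =
      ({o | (chordedCycleEdge j o).map c ∈ labelStar v} : Finset _).image
        fun o => (chordedCycleEdge j o).map c := by
    ext e
    simp only [missingLabels, mem_sdiff, mem_univ, true_and, not_not, mem_image, mem_filter]
    constructor
    · rintro ⟨h, o, rfl⟩; exact ⟨o, h, rfl⟩
    · rintro ⟨o, h, rfl⟩; exact ⟨h, o, rfl⟩
  have h3 := card_inter_add_card_sdiff (labelStar v) (missingLabels c j)
  rw [h2, card_image_of_injective _ hc, h1, inter_comm] at h3
  rw [← card_labelStar v, ← h3]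
  ring

/-- The number of non-loop edges at `v` in the complete graph is `card α - 1`, and the number of those
used by the chorded cycle is odd if `v` is exactly one of the two colours of the chord, even
otherwise. -/
lemma odd_card_missingLabels {c : Fin (m + 2) → α} {j : Fin (m + 2)}
    (hc : Function.Injective fun o => (chordedCycleEdge j o).map c) (v : α) :
    Odd (Fintype.card α + #(missingLabels c j ∩ labelStar v) +
      if s(c 0, c j) ∈ labelStar v then 1 else 0) := by
  obtain ⟨x, hx⟩ := even_card_cycle_labels c v
  rw [← card_labels_at hc v, hx]
  exact ⟨#(missingLabels c j ∩ labelStar v) + x + if s(c 0, c j) ∈ labelStar v then 1 else 0,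
    by ring⟩

lemma sum_card_inter_labelStar_le (M : Finset (Sym2 α)) :
    ∑ v : α, #(M ∩ labelStar v) ≤ 2 * #M := by
  have h : ∑ v : α, #(M ∩ labelStar v) = ∑ e ∈ M, #{v | e ∈ labelStar v} := by
    simp_rw [← filter_mem_eq_inter]
    exact sum_card_bipartiteAbove_eq_sum_card_bipartiteBelow (fun v e => e ∈ labelStar v)
  rw [h, mul_comm, ← smul_eq_mul]
  refine sum_le_card_nsmul _ _ _ fun e _ => ?_
  induction e using Sym2.ind with
  | _ a b =>
    refine (card_le_card (t := {a, b}) fun v hv => ?_).trans card_le_two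
    simp only [mem_filter, mem_univ, true_and, mk_mem_labelStar] at hv
    simp only [mem_insert, mem_singleton]
    grind

/-- If the number of colours is even, then some label is missing at every colour that is not on the
chord. -/
lemma card_le_of_even {c : Fin (m + 2) → α} {j : Fin (m + 2)}
    (hc : Function.Injective fun o => (chordedCycleEdge j o).map c)
    (hα : Even (Fintype.card α)) : 2 * (m + 3) ≤ Fintype.card α ^ 2 + 2 := by
  have h1 : ∀ v ∈ univ \ {c 0, c j}, 1 ≤ #(missingLabels c j ∩ labelStar v) := by
    intro v hv
    simp only [mem_sdiff, mem_univ, mem_insert, mem_singleton, true_and, not_or] at hv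
    have h := odd_card_missingLabels hc v
    rw [if_neg (by rw [mk_mem_labelStar]; grind), add_zero, Nat.odd_add] at h
    by_contra! h0
    have h0 : #(missingLabels c j ∩ labelStar v) = 0 := by omega
    rw [h0] at h
    exact (Nat.not_odd_iff_even.2 hα) (h.2 Even.zero)
  have h2 : Fintype.card α ≤ #(univ \ {c 0, c j}) + 2 := by
    have := card_le_card_sdiff_add_card (s := univ) (t := {c 0, c j})
    have := card_le_two (a := c 0) (b := c j)
    rw [card_univ] at *
    omega
  have h3 := card_nsmul_le_sum _ _ _ h1
  have h4 := (sum_le_univ_sum_of_nonneg (s := univ \ {c 0, c j})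
    fun v => Nat.zero_le #(missingLabels c j ∩ labelStar v)).trans (sum_card_inter_labelStar_le _)
  have h5 := two_mul_card_add_card_missingLabels hc
  rw [smul_eq_mul, mul_one] at h3
  nlinarith

/-- If the number of colours is odd and the chord cuts off a triangle, then some label is missing at
each of the two colours of the chord, and it is not the label of the chord. -/
lemma card_le_of_odd {c : Fin (m + 4) → α}
    (hc : Function.Injective fun o => (chordedCycleEdge 2 o).map c)
    (hα : Odd (Fintype.card α)) :
    2 * (m + 5) + 4 ≤ Fintype.card α * (Fintype.card α + 1) := by
  have hne := chord_ne hc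
  have h1 : ∀ v, v = c 0 ∨ v = c 2 → ∃ e ∈ missingLabels c 2, e ∈ labelStar v := by
    intro v hv
    have h := odd_card_missingLabels hc v
    rw [if_pos (by rw [mk_mem_labelStar]; grind)] at h
    by_contra! h0
    have h0 : missingLabels c 2 ∩ labelStar v = ∅ := by
      ext e; simpa using h0 e
    rw [h0, card_empty, add_zero] at h
    exact (Nat.not_odd_iff_even.2 hα.add_one) h
  obtain ⟨e, he, he'⟩ := h1 _ (Or.inl rfl)
  obtain ⟨f, hf, hf'⟩ := h1 _ (Or.inr rfl)
  have hef : e ≠ f := by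
    rintro rfl
    have : e = s(c 0, c 2) := by
      induction e using Sym2.ind with
      | _ a b =>
        rw [mk_mem_labelStar] at he' hf'
        rw [Sym2.eq_iff]
        grind
    simp only [missingLabels, mem_sdiff, mem_image, not_exists, not_and] at he
    exact he.2 none (mem_univ _) this.symm
  have h2 : 1 < #(missingLabels c 2) := one_lt_card.2 ⟨e, he, f, hf, hef⟩
  have h3 := two_mul_card_add_card_missingLabels hc
  omega

/-- With four colours and a chord that cuts off a triangle, let `x` be the colour of the apex of the
triangle. Three labels contain `x` once. The triangle uses two of them, so by parity the third one is
missing, and then `x` is not used elsewhere, so the label `{x, x}` is missing, too. -/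
lemma le_three_of_card_eq_four {c : Fin (m + 4) → α}
    (hc : Function.Injective fun o => (chordedCycleEdge 2 o).map c)
    (hα : Fintype.card α = 4) : m ≤ 3 := by
  have hne := chord_ne hc
  have h10 : c 1 ≠ c 0 := by
    intro h
    have := @hc none (some 1) (by
      simp only [chordedCycleEdge, Sym2.map_mk, h]
      rfl)
    simp at this
  have h12 : c 1 ≠ c 2 := by
    intro h
    have := @hc none (some 0) (by simp [chordedCycleEdge, h])
    simp at this
  have hsub : ({0, 1} : Finset (Fin (m + 4))) ⊆
      ({i | s(c i, c (i + 1)) ∈ labelStar (c 1)} : Finset _) := by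
    intro i hi
    simp only [mem_insert, mem_singleton] at hi
    simp only [mem_filter, mem_univ, true_and, mk_mem_labelStar]
    rcases hi with rfl | rfl
    · simp [h10.symm]
    · have : (1 : Fin (m + 4)) + 1 = 2 := rfl
      simp [this, h12.symm]
  have h01 : #({0, 1} : Finset (Fin (m + 4))) = 2 := card_pair (by simp)
  have hle := card_le_card hsub
  have hcard : #(missingLabels c 2 ∩ labelStar (c 1)) +
      #{i | s(c i, c (i + 1)) ∈ labelStar (c 1)} + 0 + 1 = 4 := by
    have h := card_labels_at hc (c 1)
    rw [if_neg (by rw [mk_mem_labelStar]; grind), hα] at h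
    exact h
  have heven : Even #{i | s(c i, c (i + 1)) ∈ labelStar (c 1)} := even_card_cycle_labels c (c 1)
  have htwo : #{i | s(c i, c (i + 1)) ∈ labelStar (c 1)} = 2 := by
    have h3 : #{i | s(c i, c (i + 1)) ∈ labelStar (c 1)} ≠ 3 := by
      intro h; rw [h] at heven; exact absurd heven (by decide)
    omega
  have heq := eq_of_subset_of_card_le hsub (by omega)
  have hrest : ∀ i : ℕ, (hi : i + 2 < m + 4) → c ⟨i + 2, hi⟩ ≠ c 1 := by
    intro i
    induction i with
    | zero => intro _; exact h12.symm
    | succ i ih =>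
      intro hi h
      have hs : (⟨i + 2, by omega⟩ : Fin (m + 4)) + 1 = ⟨i + 1 + 2, hi⟩ := by
        ext
        rw [Fin.val_add_one, if_neg (by simp [Fin.ext_iff]; omega)]
      have : (⟨i + 2, by omega⟩ : Fin (m + 4)) ∈
          ({i | s(c i, c (i + 1)) ∈ labelStar (c 1)} : Finset _) := by
        simp only [mem_filter, mem_univ, true_and, mk_mem_labelStar, hs]
        simp [h, ih (by omega)]
      rw [← heq] at this
      simp [Fin.ext_iff] at this
  have hloop : s(c 1, c 1) ∈ missingLabels c 2 := by
    simp only [missingLabels, mem_sdiff, mem_univ, true_and, mem_image, not_exists]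
    rintro (_ | i) h
    · simp [chordedCycleEdge, h10.symm] at h
    · simp only [chordedCycleEdge, Sym2.map_mk, Sym2.eq_iff, or_self] at h
      have hi : i = 1 := by
        obtain ⟨i, hi⟩ := i
        match i, hi with
        | 0, _ => exact absurd h.1 h10.symm
        | 1, _ => rfl
        | i + 2, hi => exact absurd h.1 (hrest i hi)
      subst hi
      exact h12 h.2.symm
  obtain ⟨e, he⟩ : (missingLabels c 2 ∩ labelStar (c 1)).Nonempty := by
    rw [← card_pos]; omega
  rw [mem_inter] at he
  have hef : s(c 1, c 1) ≠ e := by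
    rintro rfl
    simpa [mk_mem_labelStar] using he.2
  have h2 : 1 < #(missingLabels c 2) := one_lt_card.2 ⟨_, hloop, e, he.1, hef⟩
  have h3 := two_mul_card_add_card_missingLabels hc
  rw [hα] at h3
  omega

end labels

/-! ### Lower bounds for the chromatic number -/

namespace SimpleGraph.IsEdgeDistinguishing
variable {n j k : ℕ} {c : Fin n → Fin k}

/-- The colouring in the form to which the counting lemmas apply, with `n` written as `m + 4`. -/
lemma injective_label (hc : (chordedCycle n j).IsEdgeDistinguishing c) (hj : 2 ≤ j)
    (hjn : 2 * j ≤ n) : ∃ m, ∃ h : n = m + 4, Function.Injective fun o =>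
      (chordedCycleEdge (m := m + 2) (Fin.ofNat _ j) o).map fun i => c (i.cast h.symm) := by
  obtain ⟨m, rfl⟩ : ∃ m, n = m + 4 := ⟨n - 4, by omega⟩
  have hval : (Fin.ofNat (m + 2 + 2) j).val = j := Nat.mod_eq_of_lt (by omega)
  refine ⟨m, rfl, (isEdgeDistinguishing_chordedCycle_iff (m := m + 2) ?_ ?_ c).1 ?_⟩
  · omega
  · omega
  · rwa [hval]

lemma two_mul_le (hc : (chordedCycle n j).IsEdgeDistinguishing c) (hj : 2 ≤ j)
    (hjn : 2 * j ≤ n) : 2 * (n + 1) ≤ k * (k + 1) := by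
  obtain ⟨m, rfl, h⟩ := hc.injective_label hj hjn
  have := two_mul_card_add_card_missingLabels h
  rw [Fintype.card_fin] at this
  omega

lemma two_mul_le_of_even (hc : (chordedCycle n j).IsEdgeDistinguishing c) (hj : 2 ≤ j)
    (hjn : 2 * j ≤ n) (hk : Even k) : 2 * (n + 1) ≤ k ^ 2 + 2 := by
  obtain ⟨m, rfl, h⟩ := hc.injective_label hj hjn
  simpa using card_le_of_even h (by simpa using hk)

lemma two_mul_le_of_odd (hc : (chordedCycle n 2).IsEdgeDistinguishing c) (hn : 4 ≤ n)
    (hk : Odd k) : 2 * (n + 1) + 4 ≤ k * (k + 1) := by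
  obtain ⟨m, rfl, h⟩ := hc.injective_label le_rfl hn
  simpa using card_le_of_odd h (by simpa using hk)

lemma le_seven (hc : (chordedCycle n 2).IsEdgeDistinguishing c) (hn : 4 ≤ n)
    (hk : k = 4) : n ≤ 7 := by
  obtain ⟨m, rfl, h⟩ := hc.injective_label le_rfl hn
  have := le_three_of_card_eq_four h (by simpa using hk)
  omega

end SimpleGraph.IsEdgeDistinguishing

/-! ### The chromatic number -/

lemma SimpleGraph.edcn_eq {V : Type*} {G : SimpleGraph V} {k : ℕ} (hk : 0 < k)
    (h : ∃ c : V → Fin k, G.IsEdgeDistinguishing c)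
    (hmin : ∀ (l : ℕ) (c : V → Fin l), G.IsEdgeDistinguishing c → k ≤ l) : G.edcn = k :=
  le_antisymm (Nat.sInf_le ⟨hk, h⟩)
    (le_csInf ⟨k, hk, h⟩ fun l ⟨_, c, hc⟩ => hmin l c hc)

lemma ceil_triangular_root_le_iff (s k : ℕ) :
    ⌈(-1 + √(8 * (s : ℝ) + 1)) / 2⌉₊ ≤ k ↔ 2 * s ≤ k * (k + 1) := by
  have h : (-1 + √(8 * (s : ℝ) + 1)) / 2 ≤ k ↔ √(8 * (s : ℝ) + 1) ≤ 2 * k + 1 := by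
    constructor <;> intro h <;> linarith
  rw [Nat.ceil_le, h, Real.sqrt_le_left (by positivity), ← Nat.cast_le (α := ℝ)]
  push_cast
  constructor <;> intro h <;> nlinarith

lemma ceil_sqrt_le_iff (e k : ℕ) : ⌈√(2 * (e : ℝ) - 2)⌉₊ ≤ k ↔ 2 * e ≤ k ^ 2 + 2 := by
  rw [Nat.ceil_le, Real.sqrt_le_left (by positivity), ← Nat.cast_le (α := ℝ)]
  push_cast
  constructor <;> intro h <;> linarith

/-- Here `m` is the least number of colours allowed by the bound `2 * e ≤ k * (k + 1)` and `q` the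
least one allowed by `2 * e ≤ k ^ 2 + 2`. The second bound applies to even `k` only, so it is
decisive if `m` is even, in which case `q` is `m` or `m + 1`. -/
lemma edcn_chordedCycle {n j : ℕ} (hj : 3 ≤ j) (hjn : 2 * j ≤ n) {m q : ℕ}
    (hm : ∀ k, m ≤ k ↔ 2 * (n + 1) ≤ k * (k + 1)) (hq : ∀ k, q ≤ k ↔ 2 * (n + 1) ≤ k ^ 2 + 2) :
    (chordedCycle n j).edcn = if Odd m then m else q := by
  have hm0 := (hm m).1 le_rfl
  have hm' : ∀ k, k < m → k * (k + 1) < 2 * (n + 1) := fun k hk => by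
    by_contra! h
    exact absurd ((hm k).2 h) (by omega)
  split_ifs with hodd
  · obtain ⟨h, rfl⟩ := hodd
    have hlow := hm' (2 * h) (by omega)
    have hh : 2 ≤ h := by
      by_contra! h2
      interval_cases h <;> omega
    refine SimpleGraph.edcn_eq (by omega) ?_ fun l c hc =>
      (hm l).2 (hc.two_mul_le (by omega) hjn)
    exact (hasThetaWord_odd hh (by nlinarith) (by nlinarith) hj hjn).exists_isEdgeDistinguishing
      (by omega) (by omega)
  · rw [Nat.not_odd_iff_even] at hodd
    have hmin : ∀ (l : ℕ) (c : Fin n → Fin l), (chordedCycle n j).IsEdgeDistinguishing c →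
        q ≤ l := by
      intro l c hc
      rw [hq]
      obtain hl | hl := Nat.even_or_odd l
      · exact hc.two_mul_le_of_even (by omega) hjn hl
      · have h1 := (hm l).2 (hc.two_mul_le (by omega) hjn)
        obtain ⟨l, rfl⟩ := hl
        obtain ⟨h, rfl⟩ := hodd
        have := (hm (2 * l)).1 (by omega)
        nlinarith
    obtain ⟨h, rfl⟩ := hodd.two_dvd
    have hh : 2 ≤ h := by
      by_contra! h2
      interval_cases h <;> omega
    have hlow := hm' (2 * h - 1) (by omega)
    obtain ⟨g, rfl⟩ : ∃ g, h = g + 1 := ⟨h - 1, by omega⟩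
    have hg : 2 * (g + 1) - 1 = 2 * g + 1 := by omega
    rw [hg] at hlow
    by_cases h2 : q ≤ 2 * (g + 1)
    · have hq' : q = 2 * (g + 1) := by
        by_contra hne
        have := (hq (2 * g + 1)).1 (by omega)
        nlinarith
      refine SimpleGraph.edcn_eq (by omega) ?_ hmin
      have h3 := (hq _).1 h2
      rw [hq']
      exact (hasThetaWord_even hh (by nlinarith) (by nlinarith) hj hjn).exists_isEdgeDistinguishing
        (by omega) (by omega)
    · have hq' : q = 2 * (g + 1) + 1 := by
        have := (hq (2 * (g + 1) + 1)).2 (by nlinarith)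
        omega
      refine SimpleGraph.edcn_eq (by omega) ?_ hmin
      rw [hq] at h2
      rw [hq']
      exact (hasThetaWord_odd hh (by nlinarith) (by nlinarith) hj hjn).exists_isEdgeDistinguishing
        (by omega) (by omega)

/-- Here `m` is the least number of colours allowed by the bound `2 * e + 4 ≤ k * (k + 1)` for odd `k`
and `q` the least one allowed by the bound `2 * e ≤ k ^ 2 + 2` for even `k`. If `m` is even, then `q`
is `m` or `m + 1`. -/
lemma edcn_chordedCycle_two {n : ℕ} (hn : 9 ≤ n) {m q : ℕ}
    (hm : ∀ k, m ≤ k ↔ 2 * (n + 1) + 4 ≤ k * (k + 1))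
    (hq : ∀ k, q ≤ k ↔ 2 * (n + 1) ≤ k ^ 2 + 2) :
    (chordedCycle n 2).edcn = if Odd m then m else q := by
  have hm0 := (hm m).1 le_rfl
  have hm' : ∀ k, k < m → k * (k + 1) < 2 * (n + 1) + 4 := fun k hk => by
    by_contra! h
    exact absurd ((hm k).2 h) (by omega)
  split_ifs with hodd
  · obtain ⟨h, rfl⟩ := hodd
    have hlow := hm' (2 * h) (by omega)
    have hh : 2 ≤ h := by
      by_contra! h2
      interval_cases h <;> omega
    refine SimpleGraph.edcn_eq (by omega) ?_ fun l c hc => (hm l).2 ?_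
    · refine (hasThetaWord_odd_two hh ?_ (by nlinarith)).exists_isEdgeDistinguishing
        (by omega) (by omega)
      -- for `h = 2` this is the hypothesis `9 ≤ n`
      obtain rfl | h3 : h = 2 ∨ 3 ≤ h := by omega
      · omega
      · nlinarith
    · obtain hl | hl := Nat.even_or_odd l
      · have h1 := hc.two_mul_le_of_even le_rfl (by omega) hl
        obtain ⟨l, rfl⟩ := hl.two_dvd
        -- four colours fail as `9 ≤ n`, and from six colours on the bound for even `l` is smaller
        have h2 : 3 ≤ l := by
          by_contra! h2
          interval_cases l <;> omega
        nlinarith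
      · exact hc.two_mul_le_of_odd (by omega) hl
  · rw [Nat.not_odd_iff_even] at hodd
    have hmin : ∀ (l : ℕ) (c : Fin n → Fin l), (chordedCycle n 2).IsEdgeDistinguishing c →
        q ≤ l := by
      intro l c hc
      rw [hq]
      obtain hl | hl := Nat.even_or_odd l
      · exact hc.two_mul_le_of_even le_rfl (by omega) hl
      · have h1 := (hm l).2 (hc.two_mul_le_of_odd (by omega) hl)
        obtain ⟨l, rfl⟩ := hl
        obtain ⟨h, rfl⟩ := hodd
        have := (hm (2 * l)).1 (by omega)
        nlinarith
    obtain ⟨h, rfl⟩ := hodd.two_dvd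
    have hh : 3 ≤ h := by
      by_contra! h2
      interval_cases h <;> omega
    have hlow := hm' (2 * h - 1) (by omega)
    obtain ⟨g, rfl⟩ : ∃ g, h = g + 1 := ⟨h - 1, by omega⟩
    have hg : 2 * (g + 1) - 1 = 2 * g + 1 := by omega
    rw [hg] at hlow
    by_cases h2 : q ≤ 2 * (g + 1)
    · have hq' : q = 2 * (g + 1) := by
        by_contra hne
        have h3 := (hq (2 * g + 1)).1 (by omega)
        have h4 : 2 * g ^ 2 + 3 * g ≤ n + 1 := by nlinarith
        nlinarith
      refine SimpleGraph.edcn_eq (by omega) ?_ hmin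
      have h3 := (hq _).1 h2
      rw [hq']
      exact (hasThetaWord_even_two (by omega) (by nlinarith) (by nlinarith)
        (by omega)).exists_isEdgeDistinguishing (by omega) (by omega)
    · have hq' : q = 2 * (g + 1) + 1 := by
        have := (hq (2 * (g + 1) + 1)).2 (by nlinarith)
        omega
      refine SimpleGraph.edcn_eq (by omega) ?_ hmin
      rw [hq] at h2
      rw [hq']
      exact (hasThetaWord_odd_two (by omega) (by nlinarith)
        (by nlinarith)).exists_isEdgeDistinguishing (by omega) (by omega)

lemma four_le_of_isEdgeDistinguishing_two {n l : ℕ} (hn : 4 ≤ n) {c : Fin n → Fin l}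
    (hc : (chordedCycle n 2).IsEdgeDistinguishing c) : 4 ≤ l := by
  have h1 := hc.two_mul_le le_rfl hn
  by_contra! h2
  interval_cases l
  · omega
  · omega
  · omega
  · have := hc.two_mul_le_of_odd hn (by decide)
    omega

lemma edcn_chordedCycle_two_of_le {n : ℕ} (hn : 4 ≤ n) (hn' : n ≤ 7) :
    (chordedCycle n 2).edcn = 4 :=
  SimpleGraph.edcn_eq (by omega) ((hasThetaWord_even_two (h := 2) le_rfl (by omega) (by omega)
    (by omega)).exists_isEdgeDistinguishing le_rfl hn) fun _ _ hc =>
      four_le_of_isEdgeDistinguishing_two hn hc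

lemma edcn_chordedCycle_eight_two : (chordedCycle 8 2).edcn = 5 :=
  SimpleGraph.edcn_eq (by omega)
    (hasThetaWord_five_eight_two.exists_isEdgeDistinguishing le_rfl (by omega)) fun l c hc => by
      have h1 := four_le_of_isEdgeDistinguishing_two (by omega) hc
      have h2 : l ≠ 4 := fun hl => absurd (hc.le_seven (by omega) hl) (by omega)
      omega

theorem mainTheorem2 (n j e : ℕ) (hj : 2 ≤ j) (hjn : 2 * j ≤ n) (he : e = n + 1) :
    (chordedCycle n j).edgeSet.ncard = e ∧
    (j = 2 →
      (chordedCycle n j).edcn =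
        if e ≤ 8 then 4
        else if e = 9 then 5
        else if 10 ≤ e ∧ Odd ⌈(-1 + √(8 * (e : ℝ) + 17)) / 2⌉₊ then
          ⌈(-1 + √(8 * (e : ℝ) + 17)) / 2⌉₊
        else ⌈√(2 * (e : ℝ) - 2)⌉₊) ∧
    (3 ≤ j →
      (chordedCycle n j).edcn =
        if e ≤ 6 then 4
        else if 7 ≤ e ∧ Odd ⌈(-1 + √(8 * (e : ℝ) + 1)) / 2⌉₊ then
          ⌈(-1 + √(8 * (e : ℝ) + 1)) / 2⌉₊
        else ⌈√(2 * (e : ℝ) - 2)⌉₊) := by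
  subst he
  refine ⟨?_, ?_, fun hj3 => ?_⟩
  · obtain ⟨m, rfl⟩ : ∃ m, n = m + 2 := ⟨n - 2, by omega⟩
    obtain ⟨j, rfl⟩ : ∃ i : Fin (m + 2), i.val = j := ⟨⟨j, by omega⟩, rfl⟩
    exact ncard_edgeSet_chordedCycle hj (by omega)
  · rintro rfl
    by_cases h8 : n + 1 ≤ 8
    · rw [if_pos h8]
      exact edcn_chordedCycle_two_of_le (by omega) (by omega)
    by_cases h9 : n + 1 = 9
    · obtain rfl : n = 8 := by omega
      rw [if_neg h8, if_pos h9]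
      exact edcn_chordedCycle_eight_two
    rw [if_neg h8, if_neg h9]
    have h17 : 8 * ((n + 1 : ℕ) : ℝ) + 17 = 8 * ((n + 1 + 2 : ℕ) : ℝ) + 1 := by
      push_cast; ring
    rw [h17, edcn_chordedCycle_two (by omega)
      (fun k => by rw [ceil_triangular_root_le_iff (n + 1 + 2)]; omega) (ceil_sqrt_le_iff (n + 1))]
    simp only [show 10 ≤ n + 1 by omega, true_and]
  · rw [if_neg (by omega), edcn_chordedCycle hj3 hjn (ceil_triangular_root_le_iff (n + 1))
      (ceil_sqrt_le_iff (n + 1))]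
    simp only [show 7 ≤ n + 1 by omega, true_and]
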